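/- Let $X$ be a real Hausdorff locally convex space with topological dual $X^*$ endowed with the weak-$*$ topology, and let $\Gamma_0(X)$ be the set of proper convex lower semicontinuous functions $X\to\mathbb{R}\cup\{+\infty\}$. For $g:X\to\mathbb{R}\cup\{+\infty\}$, $x\in\operatorname{dom}g:=\{g<+\infty\}$ and $\varepsilon\ge 0$ put $$\partial_\varepsilon g(x)=\{x^*\in X^*: g(y)\ge g(x)+\langle x^*,y-x\rangle-\varepsilon\ \text{ for all } y\in X\},\qquad \partial g(x)=\partial_0 g(x),$$ and write $\overline{\operatorname{co}}$ for the weak-$*$ closed convex hull. For $\Lambda\subset\mathbb{R}$ and $A\subset X^*$, $\Lambda A=\{\lambda a:\lambda\in\Lambda,\ a\in A\}$. Let $T$ be a nonempty compact Hausdorff space and let $\{f_t\}_{t\in T}\subset\Gamma_0(X)$ be such that $t\mapsto f_t(z)$ is upper semicontinuous on $T$ for every $z\in X$. Let $f=\sup_{t\in T}f_t$ and $T(x)=\{t\in T: f_t(x)=f(x)\}$. Then for every $x\in\operatorname{dom}f$ $$\partial f(x)=\bigcap_{\varepsilon>0}\overline{\operatorname{co}}\Big(\Big(\bigcup_{t\in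 T(x)}\partial_\varepsilon f_t(x)\Big)+\Big(\bigcup_{t\in T\setminus T(x)}\{0,\varepsilon\}\,\partial_\varepsilon(\rho_t f_t)(x)\Big)\Big),$$ where the weights $\rho_t=\rho_t(\varepsilon)$ are $$\rho_t:=\frac{\varepsilon}{2f(x)-2f_t(x)+\varepsilon},\qquad t\in T\setminus T(x),$$ and where the second union is read as $\{0\}$ when $T(x)=T$. If, in addition, $f$ attains its minimum over $X$ at $x$, then, with the same weights, $$\partial f(x)=\bigcap_{\varepsilon>0}\overline{\operatorname{co}}\Big(\Big(\bigcup_{t\in T(x)}\partial_\varepsilon f_t(x)\Big)\cup\Big(\bigcup_{t\in T\setminus T(x)}\varepsilon\,\partial_\varepsilon(\rho_t f_t)(x)\Big)\Big)$$ (here an empty second union is the empty set). -/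

import Mathlib

open Set Topology
open scoped Pointwise

/-- The effective domain `{x : g x < +∞}` of an extended-real-valued function. -/
def effDomain {X : Type*} (g : X → EReal) : Set X := {x | g x < ⊤}

/-- The epigraph of `g`, as a subset of `X × ℝ`. -/
def epigraphE {X : Type*} (g : X → EReal) : Set (X × ℝ) := {p | g p.1 ≤ (p.2 : EReal)}

/-- `g ∈ Γ₀(X)`: `g` is proper, convex (its epigraph is convex) and lower semicontinuous. -/
structure IsGammaZero {X : Type*} [AddCommGroup X] [Module ℝ X] [TopologicalSpace X]
    (g : X → EReal) : Prop where
  dom_nonempty : (effDomain g).Nonempty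
  ne_bot : ∀ x, g x ≠ ⊥
  convex : Convex ℝ (epigraphE g)
  lsc : LowerSemicontinuous g

/-- The `ε`-subdifferential of `g` at `x`, a subset of the topological dual with its weak-star
topology; it is empty when `g x` is not a real number or `ε < 0`. -/
def epsSubdiff {X : Type*} [AddCommGroup X] [Module ℝ X] [TopologicalSpace X]
    (ε : ℝ) (g : X → EReal) (x : X) : Set (WeakDual ℝ X) :=
  {x' | g x ≠ ⊥ ∧ g x ≠ ⊤ ∧ 0 ≤ ε ∧
    ∀ y, g x + ((x' (y - x) - ε : ℝ) : EReal) ≤ g y}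

/-- The subdifferential `∂g(x) = ∂₀g(x)`. -/
def subdiff {X : Type*} [AddCommGroup X] [Module ℝ X] [TopologicalSpace X]
    (g : X → EReal) (x : X) : Set (WeakDual ℝ X) := epsSubdiff 0 g x

/-- The pointwise supremum of a family of functions. -/
noncomputable def supFun {X T : Type*} (f : T → X → EReal) : X → EReal := fun x => ⨆ t, f t x

/-- The active indices `T(x) = {t : f_t(x) ≥ f(x)}`, where `f` is the supremum function. -/
def activeSet {X T : Type*} (f : T → X → EReal) (x : X) : Set T := {t | supFun f x ≤ f t x}

/-- The function `r g`; it is used with a real number `r > 0` only. -/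
noncomputable def scaleFun {X : Type*} (r : ℝ) (g : X → EReal) : X → EReal :=
  fun y => (r : EReal) * g y

/-- The weight `ρ_t(ε) = ε / (2 f(x) - 2 f_t(x) + ε)`; it is used where `f x` and `f_t x` are
real numbers only. -/
noncomputable def weightRho {X T : Type*} (f : T → X → EReal) (x : X) (ε : ℝ) (t : T) : ℝ :=
  ε / (2 * (supFun f x).toReal - 2 * (f t x).toReal + ε)

/-- The set `⋃_{t ∈ T(x)} ∂_ε f_t(x)`. -/
def activePart {X T : Type*} [AddCommGroup X] [Module ℝ X] [TopologicalSpace X]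
    (f : T → X → EReal) (x : X) (ε : ℝ) : Set (WeakDual ℝ X) :=
  ⋃ t ∈ activeSet f x, epsSubdiff ε (f t) x

/-- The set `⋃_{t ∈ T ∖ T(x)} Λ ∂_ε(ρ_t f_t)(x)`, where `Λ ⊆ ℝ` and `ρ_t = ρ_t(ε)`. -/
def inactivePart {X T : Type*} [AddCommGroup X] [Module ℝ X] [TopologicalSpace X]
    (f : T → X → EReal) (x : X) (ε : ℝ) (Λ : Set ℝ) : Set (WeakDual ℝ X) :=
  ⋃ t ∈ (activeSet f x)ᶜ, Λ • epsSubdiff ε (scaleFun (weightRho f x ε t) (f t)) x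

open Classical in
/-- The set `⋃_{t ∈ T ∖ T(x)} {0, ε} ∂_ε(ρ_t f_t)(x)`, with the convention that it is `{0}` when
all indices are active. -/
noncomputable def inactiveSummand {X T : Type*} [AddCommGroup X] [Module ℝ X]
    [TopologicalSpace X] (f : T → X → EReal) (x : X) (ε : ℝ) : Set (WeakDual ℝ X) :=
  if activeSet f x = univ then {0} else inactivePart f x ε {0, ε}

/-! Inclusion `⊆`: by Hahn–Banach it suffices to bound `u z`, for each direction `z` separately. If
active `ε`-subgradients are at most `β` along `z`, then for `β' > β` each active `f t` satisfies `f
t (x + r • z) < f x - ε + β' r` at some `r > 0`. If weighted inactive ones are merely bounded above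
along `z`, then `f t` is finite somewhere on the open ray, and its gap below `f x` leaves room for
any slope. Upper semicontinuity and convexity spread both estimates to nearby indices, and
compactness of `T` gives a common step; so `u z ≤ β'` (`apply_le_of_mem_subdiff`). Inclusion `⊇`:
every generator satisfies the subgradient inequality up to `O(ε)`, and closed half-spaces pass this
to the hull (`mem_subdiff_of_forall_le`). -/

/-! ### Approximate subgradients of a single function. -/

section EpsSubdiff

variable {X : Type*} [AddCommGroup X] [Module ℝ X] [TopologicalSpace X]

/-- Membership in the `ε`-subdifferential, tested on the real upper bounds of the values. -/
theorem mem_epsSubdiff_iff {g : X → EReal} {x : X} {a ε : ℝ} (ha : g x = a) (hε : 0 ≤ ε)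
    (u : WeakDual ℝ X) :
    u ∈ epsSubdiff ε g x ↔ ∀ (y : X) (b : ℝ), g y ≤ b → u (y - x) ≤ b - a + ε := by
  have hreal (y : X) : g x + ((u (y - x) - ε : ℝ) : EReal) = ((a + (u (y - x) - ε) : ℝ) : EReal) := by
    rw [ha]; push_cast; rfl
  simp only [epsSubdiff, mem_ofPred_eq]
  constructor
  · rintro ⟨-, -, -, h⟩ y b hb
    have h1 := (h y).trans hb
    rw [hreal, EReal.coe_le_coe_iff] at h1
    linarith
  · intro h
    refine ⟨by simp [ha], by simp [ha], hε, fun y => ?_⟩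
    rw [hreal]
    refine EReal.le_of_forall_lt_iff_le.1 fun b hb => ?_
    rw [EReal.coe_le_coe_iff]
    linarith [h y b hb.le]

/-- Convexity inequality along a segment, tested on real upper bounds of the values. -/
theorem IsGammaZero.le_on_segment {g : X → EReal} (hg : IsGammaZero g) {x z : X} {s r a b : ℝ}
    (hs : 0 ≤ s) (hsr : s ≤ r) (hr : 0 < r) (ha : g x ≤ a) (hb : g (x + r • z) ≤ b) :
    g (x + s • z) ≤ ((1 - s / r) * a + s / r * b : ℝ) := by
  have h1 : s / r ≤ 1 := (div_le_one hr).2 hsr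
  have h := hg.convex (x := (x, a)) ha (y := (x + r • z, b)) hb
    (sub_nonneg.2 h1) (div_nonneg hs hr.le) (sub_add_cancel 1 (s / r))
  have e : (1 - s / r) • (x, a) + (s / r) • (x + r • z, b)
      = (x + s • z, (1 - s / r) * a + s / r * b) := by
    ext
    · simp only [Prod.fst_add, Prod.smul_fst, smul_add, smul_smul, div_mul_cancel₀ s hr.ne']
      rw [← add_assoc, ← add_smul, sub_add_cancel, one_smul]
    · simp
  rw [e] at h
  exact h

theorem smul_mem_epsSubdiff_scaleFun {g : X → EReal} {x : X} {δ r : ℝ} (hr : 0 < r)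
    (hδ : 0 ≤ δ) {a : ℝ} (ha : g x = a) {u : WeakDual ℝ X} (hu : u ∈ epsSubdiff δ g x) :
    r • u ∈ epsSubdiff (r * δ) (scaleFun r g) x := by
  have hra : scaleFun r g x = (r * a : ℝ) := by simp [scaleFun, ha]
  rw [mem_epsSubdiff_iff ha hδ] at hu
  rw [mem_epsSubdiff_iff hra (by positivity)]
  intro y b hb
  have h1 : g y ≤ (b / r : ℝ) := by
    rw [EReal.coe_div]
    rw [EReal.le_div_iff_mul_le (by exact_mod_cast hr) (by simp), mul_comm]
    exact hb
  have h2 := hu y _ h1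
  have h3 : r * u (y - x) ≤ r * (b / r - a + δ) := by gcongr
  have h4 : r * (b / r) = b := by field_simp
  change r * u (y - x) ≤ _
  linarith

theorem scaleFun_le {X : Type*} {g : X → EReal} {y : X} {r b : ℝ} (hr : 0 ≤ r) (h : g y ≤ b) :
    scaleFun r g y ≤ (r * b : ℝ) := by
  rw [EReal.coe_mul]
  exact mul_le_mul_of_nonneg_left h (by exact_mod_cast hr)

theorem IsGammaZero.isClosed_epigraphE {g : X → EReal} (hg : IsGammaZero g) :
    IsClosed (epigraphE g) :=
  hg.lsc.isClosed_epigraph.preimage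
    (continuous_fst.prodMk (continuous_coe_real_ereal.comp continuous_snd))

variable [IsTopologicalAddGroup X] [ContinuousSMul ℝ X] [LocallyConvexSpace ℝ X]

/-- The support function of the `ε`-subdifferential is at least any lower bound for the
`ε`-difference quotients in the same direction. -/
theorem IsGammaZero.exists_mem_epsSubdiff_gt {g : X → EReal} (hg : IsGammaZero g) {x z : X}
    {a ε β β' : ℝ} (ha : g x = a) (hε : 0 < ε) (hβ : β < β')
    (h : ∀ s : ℝ, 0 < s → ((a - ε + β' * s : ℝ) : EReal) ≤ g (x + s • z)) :
    ∃ u ∈ epsSubdiff ε g x, β < u z := by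
  set γ := (β + β') / 2 with hγ
  have hγβ : 0 < γ - β := by linarith
  -- A segment replaces the ray to keep compactness. Its far end only bounds the slope below by `γ -
  -- ε / N`, so `N` must make this exceed `β`.
  obtain ⟨N, hN, hNε⟩ : ∃ N : ℝ, 0 < N ∧ ε < N * (γ - β) := by
    refine ⟨2 * ε / (γ - β), by positivity, ?_⟩
    rw [div_mul_cancel₀ _ hγβ.ne']
    linarith
  have hdisj : Disjoint (segment ℝ ((x, a - ε) : X × ℝ) (x + N • z, a - ε + γ * N))
      (epigraphE g) := by
    rw [Set.disjoint_left]
    rintro p hp hpg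
    rw [segment_eq_image'] at hp
    obtain ⟨θ, ⟨hθ, -⟩, rfl⟩ := hp
    have hpg' : g (x + (θ * N) • z) ≤ ((a - ε + γ * (θ * N) : ℝ) : EReal) := by
      have e : ((x, a - ε) : X × ℝ) + θ • ((x + N • z, a - ε + γ * N) - (x, a - ε))
          = (x + (θ * N) • z, a - ε + γ * (θ * N)) := by
        ext
        · simp [smul_smul]
        · simp; ring
      beta_reduce at hpg
      rw [e] at hpg
      exact hpg
    rcases hθ.eq_or_lt with rfl | hθ
    · simp only [zero_mul, zero_smul, add_zero, ha, mul_zero, EReal.coe_le_coe_iff] at hpg'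
      linarith
    · have hθN : 0 < θ * N := by positivity
      have h1 := (h _ hθN).trans hpg'
      rw [EReal.coe_le_coe_iff] at h1
      nlinarith
  have hcomp : IsCompact (segment ℝ ((x, a - ε) : X × ℝ) (x + N • z, a - ε + γ * N)) := by
    rw [segment_eq_image']
    exact isCompact_Icc.image (by fun_prop)
  obtain ⟨φ, c₁, c₂, hφ₁, hc, hφ₂⟩ := geometric_hahn_banach_compact_closed
    (convex_segment _ _) hcomp hg.convex hg.isClosed_epigraphE hdisj
  set v : X →L[ℝ] ℝ := φ.comp (ContinuousLinearMap.inl ℝ X ℝ)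
  set α : ℝ := φ (0, 1)
  have hφ (y : X) (r : ℝ) : φ (y, r) = v y + r * α := by
    have e : ((y, r) : X × ℝ) = (y, 0) + r • (0, 1) := by ext <;> simp
    rw [e, map_add, map_smul]
    rfl
  have hp := hφ₁ _ (left_mem_segment ℝ _ _)
  have hq := hφ₁ _ (right_mem_segment ℝ _ _)
  have hx := hφ₂ (x, a) (show g x ≤ (a : EReal) from ha.le)
  simp only [hφ, map_add, map_smul, smul_eq_mul] at hp hq hx
  -- The separating hyperplane is not vertical: `(x, a - ε)` lies directly below `(x, a)`.
  have hα : 0 < α := by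
    by_contra hα
    nlinarith
  refine ⟨-(α⁻¹ • v : X →L[ℝ] ℝ), (mem_epsSubdiff_iff ha hε.le _).2 fun y b hb => ?_, ?_⟩
  · have hy := hφ₂ (y, b) hb
    rw [hφ] at hy
    change -(α⁻¹ * v (y - x)) ≤ _
    rw [map_sub, ← sub_nonneg]
    have e : b - a + ε - -(α⁻¹ * (v y - v x))
        = α⁻¹ * ((v y + b * α) - (v x + (a - ε) * α)) := by
      field_simp; ring
    rw [e]
    exact mul_nonneg (inv_nonneg.2 hα.le) (by linarith)
  · change β < -(α⁻¹ * v z)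
    have h1 : N * v z < α * (ε - γ * N) := by linarith
    have h2 : N * v z < N * (-(β * α)) := by nlinarith
    have h3 := lt_of_mul_lt_mul_left h2 hN.le
    rw [← mul_neg, inv_mul_eq_div, lt_div_iff₀ hα]
    linarith

theorem IsGammaZero.epsSubdiff_nonempty {g : X → EReal} (hg : IsGammaZero g) {x : X}
    {a ε : ℝ} (ha : g x = a) (hε : 0 < ε) : (epsSubdiff ε g x).Nonempty := by
  obtain ⟨u, hu, -⟩ := hg.exists_mem_epsSubdiff_gt (z := 0) (β := -1) (β' := 0) ha hε (by norm_num)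
    (fun s _ => by simp only [smul_zero, add_zero, ha, EReal.coe_le_coe_iff]; linarith)
  exact ⟨u, hu⟩

end EpsSubdiff

/-! ### Weights, local estimates near an index, and compactness. -/

section SupFun

variable {X T : Type*} {f : T → X → EReal} {x : X}

theorem le_supFun (f : T → X → EReal) (t : T) (y : X) : f t y ≤ supFun f y :=
  le_iSup (fun t => f t y) t

theorem weightRho_pos {t : T} {F a ε : ℝ} (hF : supFun f x = F) (ha : f t x = a) (hε : 0 < ε) :
    0 < weightRho f x ε t := by
  have h : a ≤ F := by
    rw [← EReal.coe_le_coe_iff, ← hF, ← ha]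
    exact le_supFun f t x
  simp only [weightRho, hF, ha, EReal.toReal_coe]
  exact div_pos hε (by linarith)

theorem weightRho_le_one {t : T} {F a ε : ℝ} (hF : supFun f x = F) (ha : f t x = a) (hε : 0 < ε) :
    weightRho f x ε t ≤ 1 := by
  have h : a ≤ F := by
    rw [← EReal.coe_le_coe_iff, ← hF, ← ha]
    exact le_supFun f t x
  simp only [weightRho, hF, ha, EReal.toReal_coe]
  exact (div_le_one (by linarith)).2 (by linarith)

/-- This is what the weight is designed for: replacing `f t x` by `f x` costs `O(ε)`, however large
the gap. -/
theorem weightRho_mul_sub_le {t : T} {F a ε : ℝ} (hF : supFun f x = F) (ha : f t x = a)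
    (hε : 0 < ε) : weightRho f x ε t * (F - a) ≤ ε / 2 := by
  have h : a ≤ F := by
    rw [← EReal.coe_le_coe_iff, ← hF, ← ha]
    exact le_supFun f t x
  simp only [weightRho, hF, ha, EReal.toReal_coe]
  rw [div_mul_eq_mul_div, div_le_div_iff₀ (by linarith) (by norm_num)]
  nlinarith

theorem eq_of_mem_activeSet {t : T} (ht : t ∈ activeSet f x) : f t x = supFun f x :=
  le_antisymm (le_supFun f t x) ht

theorem lt_of_mem_compl_activeSet {t : T} (ht : t ∈ (activeSet f x)ᶜ) : f t x < supFun f x :=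
  not_le.1 ht

theorem activeSet_nonempty [TopologicalSpace T] [CompactSpace T] [Nonempty T]
    (husc : UpperSemicontinuous fun t => f t x) : (activeSet f x).Nonempty := by
  obtain ⟨t, -, ht⟩ := (husc.upperSemicontinuousOn univ).exists_isMaxOn univ_nonempty isCompact_univ
  exact ⟨t, show supFun f x ≤ f t x from iSup_le fun s => ht (mem_univ s)⟩

theorem exists_coe_eq_of_le {t : T} {F : ℝ} (hF : supFun f x = F) (hbot : f t x ≠ ⊥) :
    ∃ a : ℝ, f t x = a ∧ a ≤ F := by
  have h := le_supFun f t x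
  rw [hF] at h
  lift f t x to ℝ using ⟨(h.trans_lt (EReal.coe_lt_top F)).ne, hbot⟩ with a
  exact ⟨a, rfl, EReal.coe_le_coe_iff.1 h⟩

variable [AddCommGroup X] [Module ℝ X] [TopologicalSpace X]

/-- Elements of `∂_ε f_t(x)`, `t` active, are `ε`-subgradients of the supremum. -/
theorem apply_le_of_mem_activePart {F ε : ℝ} (hF : supFun f x = F) (hε : 0 < ε)
    {u : WeakDual ℝ X} (hu : u ∈ activePart f x ε) {y : X} {b : ℝ} (hb : supFun f y ≤ b) :
    u (y - x) ≤ b - F + ε := by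
  simp only [activePart, mem_iUnion] at hu
  obtain ⟨t, ht, hu⟩ := hu
  exact (mem_epsSubdiff_iff ((eq_of_mem_activeSet ht).trans hF) hε.le _).1 hu y b
    ((le_supFun f t y).trans hb)

/-- Split `ρ (b - a) = ρ (b - F) + ρ (F - a)`. Only `0 < ρ ≤ 1` is known, so the first term is
controlled by a positive part. -/
theorem apply_le_of_mem_weighted {F ε : ℝ} (hF : supFun f x = F) (hε : 0 < ε) {t : T}
    (hbot : f t x ≠ ⊥) {w : WeakDual ℝ X}
    (hw : w ∈ epsSubdiff ε (scaleFun (weightRho f x ε t) (f t)) x) {y : X} {b : ℝ}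
    (hb : supFun f y ≤ b) : w (y - x) ≤ max (b - F) 0 + 2 * ε := by
  obtain ⟨a, ha, -⟩ := exists_coe_eq_of_le hF hbot
  have hρ := weightRho_pos hF ha hε
  have hρ1 := weightRho_le_one hF ha hε
  have hρ2 := weightRho_mul_sub_le hF ha hε
  set ρ := weightRho f x ε t
  have hρa : scaleFun ρ (f t) x = (ρ * a : ℝ) := by simp [scaleFun, ha]
  have h := (mem_epsSubdiff_iff hρa hε.le _).1 hw y _
    (scaleFun_le hρ.le ((le_supFun f t y).trans hb))
  have h1 : ρ * (b - F) ≤ max (b - F) 0 :=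
    (mul_le_mul_of_nonneg_left (le_max_left _ 0) hρ.le).trans
      (mul_le_of_le_one_left (le_max_right _ _) hρ1)
  linarith

theorem apply_le_of_mem_closure_convexHull {A : Set (WeakDual ℝ X)} {z : X} {c : ℝ}
    (h : ∀ u ∈ A, u z ≤ c) {u : WeakDual ℝ X} (hu : u ∈ closure (convexHull ℝ A)) : u z ≤ c := by
  have hcl : IsClosed {u : WeakDual ℝ X | u z ≤ c} :=
    isClosed_le (WeakDual.eval_continuous z) continuous_const
  have hco : Convex ℝ {u : WeakDual ℝ X | u z ≤ c} := by
    intro u hu v hv p q hp hq hpq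
    change p * u z + q * v z ≤ c
    calc p * u z + q * v z ≤ p * c + q * c := by gcongr <;> assumption
      _ = c := by rw [← add_mul, hpq, one_mul]
  exact closure_minimal (convexHull_min h hco) hcl hu

/-- A functional lies in the subdifferential once all its subgradient inequalities hold up to an
error that tends to zero with `ε`. -/
theorem mem_subdiff_of_forall_le {F : ℝ} (hF : supFun f x = F) {A : ℝ → Set (WeakDual ℝ X)}
    (h : ∀ (y : X) (b : ℝ), supFun f y ≤ b → ∃ C : ℝ, ∀ ε : ℝ, 0 < ε → ε ≤ 1 →
      ∀ u ∈ A ε, u (y - x) ≤ b - F + C * ε)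
    {u : WeakDual ℝ X} (hu : ∀ ε : ℝ, 0 < ε → u ∈ closure (convexHull ℝ (A ε))) :
    u ∈ subdiff (supFun f) x := by
  refine (mem_epsSubdiff_iff hF le_rfl _).2 fun y b hb => ?_
  obtain ⟨C, hC⟩ := h y b hb
  rw [add_zero]
  have hlim : Filter.Tendsto (fun ε : ℝ => b - F + C * ε) (𝓝[>] 0) (𝓝 (b - F)) := by
    have : Continuous fun ε : ℝ => b - F + C * ε := by fun_prop
    simpa using (this.tendsto 0).mono_left nhdsWithin_le_nhds
  refine ge_of_tendsto hlim ?_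
  filter_upwards [Ioc_mem_nhdsGT (zero_lt_one' ℝ)] with ε hε
  exact apply_le_of_mem_closure_convexHull (hC ε hε.1 hε.2) (hu ε hε.1)

/-- A point outside a weak-star closed convex hull is strictly separated from it by a vector. -/
theorem exists_separating_vector {A : Set (WeakDual ℝ X)} {u : WeakDual ℝ X}
    (hu : u ∉ closure (convexHull ℝ A)) :
    ∃ (z : X) (β : ℝ), β < u z ∧ ∀ v ∈ A, v z ≤ β := by
  have : LocallyConvexSpace ℝ (WeakDual ℝ X) :=
    inferInstanceAs (LocallyConvexSpace ℝ (WeakBilin (topDualPairing ℝ X)))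
  obtain ⟨φ, β, hφ, hβ⟩ := geometric_hahn_banach_closed_point
    (convex_convexHull ℝ A).closure isClosed_closure hu
  obtain ⟨z, hz⟩ := LinearMap.dualEmbedding_surjective (topDualPairing ℝ X) φ
  have hφz (v : WeakDual ℝ X) : φ v = v z := by
    rw [← hz]; rfl
  refine ⟨z, β, by rwa [← hφz], fun v hv => ?_⟩
  rw [← hφz]
  exact (hφ v (subset_closure (subset_convexHull ℝ A hv))).le

theorem eventually_le_of_inactive [TopologicalSpace T] {F b β r : ℝ} (hF : supFun f x = F)
    (hf : ∀ t, IsGammaZero (f t)) (husc : ∀ z, UpperSemicontinuous fun t => f t z) {t : T}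
    (ht : t ∈ (activeSet f x)ᶜ) {z : X} (hr : 0 < r) (hb : f t (x + r • z) < b) :
    ∃ r : ℝ, 0 < r ∧ ∀ᶠ t' in 𝓝 t, ∀ s : ℝ, 0 < s → s ≤ r →
      f t' (x + s • z) ≤ (F + β * s : ℝ) := by
  obtain ⟨a, ha, haF⟩ := EReal.lt_iff_exists_real_btwn.1 (lt_of_mem_compl_activeSet ht)
  rw [hF, EReal.coe_lt_coe_iff] at haF
  -- `K` dominates the excess of the chord's slope over `β`; up to `s = (F - a) / K` the gap absorbs
  -- it.
  set K := |(b - a) / r - β| + 1 with hK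
  have hKpos : 0 < K := by positivity
  refine ⟨min r ((F - a) / K), lt_min hr (div_pos (by linarith) hKpos), ?_⟩
  filter_upwards [husc _ t _ hb, husc _ t _ ha] with t' hb' ha' s hs hsr
  refine ((hf t').le_on_segment hs.le (hsr.trans (min_le_left _ _)) hr ha'.le hb'.le).trans ?_
  rw [EReal.coe_le_coe_iff]
  have h1 : s * K ≤ F - a := (le_div_iff₀ hKpos).1 (hsr.trans (min_le_right _ _))
  have h2 : s * ((b - a) / r - β) ≤ s * K :=
    mul_le_mul_of_nonneg_left ((le_abs_self _).trans (by linarith)) hs.le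
  have e : (1 - s / r) * a + s / r * b = a + s * ((b - a) / r - β) + β * s := by
    field_simp; ring
  linarith

variable [IsTopologicalAddGroup X] [ContinuousSMul ℝ X] [LocallyConvexSpace ℝ X]

theorem epsSubdiff_weighted_nonempty {F ε : ℝ} (hF : supFun f x = F) (hε : 0 < ε) {t : T}
    (hft : IsGammaZero (f t)) :
    (epsSubdiff ε (scaleFun (weightRho f x ε t) (f t)) x).Nonempty := by
  obtain ⟨a, ha, -⟩ := exists_coe_eq_of_le hF (hft.ne_bot x)
  have hρ := weightRho_pos hF ha hε
  obtain ⟨u, hu⟩ := hft.epsSubdiff_nonempty ha (div_pos hε hρ)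
  have h := smul_mem_epsSubdiff_scaleFun hρ (div_pos hε hρ).le ha hu
  rw [mul_div_cancel₀ _ hρ.ne'] at h
  exact ⟨_, h⟩

/-- If the weighted `ε`-subdifferential is bounded above in the direction `z`, then the effective
domain of `f t` contains a point `x + s z` with `s > 0`. -/
theorem exists_lt_coe_of_bddAbove {F ε M : ℝ} (hF : supFun f x = F) (hε : 0 < ε) {t : T} {z : X}
    (hft : IsGammaZero (f t))
    (hM : ∀ w ∈ epsSubdiff ε (scaleFun (weightRho f x ε t) (f t)) x, w z ≤ M) :
    ∃ s b : ℝ, 0 < s ∧ f t (x + s • z) < b := by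
  obtain ⟨a, ha, -⟩ := exists_coe_eq_of_le hF (hft.ne_bot x)
  have hρ := weightRho_pos hF ha hε
  by_contra! hcon
  have htop (s : ℝ) (hs : 0 < s) : f t (x + s • z) = ⊤ := by
    by_contra h
    obtain ⟨b, hb⟩ := EReal.lt_iff_exists_real_btwn.1 (lt_top_iff_ne_top.2 h)
    exact (hcon s b hs).not_gt hb.1
  obtain ⟨u, hu, huz⟩ := hft.exists_mem_epsSubdiff_gt (z := z) ha (div_pos hε hρ)
    (lt_add_one (M / weightRho f x ε t)) (fun s hs => by rw [htop s hs]; exact le_top)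
  have h := smul_mem_epsSubdiff_scaleFun hρ (div_pos hε hρ).le ha hu
  rw [mul_div_cancel₀ _ hρ.ne'] at h
  have h1 : weightRho f x ε t * u z ≤ M := hM _ h
  rw [div_lt_iff₀ hρ] at huz
  linarith

variable [TopologicalSpace T]

/-- The strict inequality at one step `r` survives for nearby indices, and each of these is at most
`F` at `x`, so convexity fills in `0 < s ≤ r`. -/
theorem eventually_le_of_active {F ε β β' : ℝ} (hF : supFun f x = F) (hε : 0 < ε) (hβ : β < β')
    (hf : ∀ t, IsGammaZero (f t)) (husc : ∀ z, UpperSemicontinuous fun t => f t z) {t : T}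
    (ht : t ∈ activeSet f x) {z : X} (hz : ∀ u ∈ epsSubdiff ε (f t) x, u z ≤ β) :
    ∃ r : ℝ, 0 < r ∧ ∀ᶠ t' in 𝓝 t, ∀ s : ℝ, 0 < s → s ≤ r →
      f t' (x + s • z) ≤ (F + β' * s : ℝ) := by
  have ha := (eq_of_mem_activeSet ht).trans hF
  obtain ⟨r, hr, hlt⟩ : ∃ r : ℝ, 0 < r ∧ f t (x + r • z) < (F - ε + β' * r : ℝ) := by
    by_contra! hcon
    obtain ⟨u, hu, huz⟩ := (hf t).exists_mem_epsSubdiff_gt ha hε hβ hcon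
    exact (hz u hu).not_gt huz
  refine ⟨r, hr, ?_⟩
  filter_upwards [husc _ t _ hlt] with t' ht' s hs hsr
  refine ((hf t').le_on_segment hs.le hsr hr ((le_supFun f t' x).trans hF.le) ht'.le).trans ?_
  rw [EReal.coe_le_coe_iff]
  have e : (1 - s / r) * F + s / r * (F - ε + β' * r) = F + β' * s - s / r * ε := by
    field_simp; ring
  rw [e]
  have : 0 < s / r * ε := by positivity
  linarith

variable [CompactSpace T]

/-- Direction by direction, a subgradient of the supremum is dominated by the active
`ε`-subgradients, as soon as the inactive weighted ones are bounded above. -/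
theorem apply_le_of_mem_subdiff {F ε β : ℝ} (hF : supFun f x = F) (hε : 0 < ε)
    (hf : ∀ t, IsGammaZero (f t)) (husc : ∀ z, UpperSemicontinuous fun t => f t z) {z : X}
    (hact : ∀ u ∈ activePart f x ε, u z ≤ β)
    (hinact : ∀ t ∈ (activeSet f x)ᶜ, ∃ M : ℝ,
      ∀ w ∈ epsSubdiff ε (scaleFun (weightRho f x ε t) (f t)) x, w z ≤ M)
    {u : WeakDual ℝ X} (hu : u ∈ subdiff (supFun f) x) : u z ≤ β := by
  by_contra! hlt
  obtain ⟨β', hβ, hβu⟩ := exists_between hlt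
  have hloc (t : T) : ∃ r : ℝ, 0 < r ∧ ∀ᶠ t' in 𝓝 t, ∀ s : ℝ, 0 < s → s ≤ r →
      f t' (x + s • z) ≤ (F + β' * s : ℝ) := by
    by_cases ht : t ∈ activeSet f x
    · exact eventually_le_of_active hF hε hβ hf husc ht fun u hu =>
        hact u (mem_iUnion₂.2 ⟨t, ht, hu⟩)
    · obtain ⟨M, hM⟩ := hinact t ht
      obtain ⟨s, b, hs, hb⟩ := exists_lt_coe_of_bddAbove hF hε (hf t) hM
      exact eventually_le_of_inactive hF hf husc ht hs hb
  obtain ⟨r, hr, hall⟩ : ∃ r : ℝ, 0 < r ∧ ∀ t ∈ (univ : Set T), ∀ s : ℝ, 0 < s → s ≤ r →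
      f t (x + s • z) ≤ (F + β' * s : ℝ) := by
    refine isCompact_univ.induction_on (p := fun S : Set T => ∃ r : ℝ, 0 < r ∧ ∀ t ∈ S,
      ∀ s : ℝ, 0 < s → s ≤ r → f t (x + s • z) ≤ (F + β' * s : ℝ)) ⟨1, one_pos, by simp⟩ ?_ ?_ ?_
    · rintro S S' hSS' ⟨r, hr, h⟩
      exact ⟨r, hr, fun t ht => h t (hSS' ht)⟩
    · rintro S S' ⟨r, hr, h⟩ ⟨r', hr', h'⟩
      refine ⟨min r r', lt_min hr hr', ?_⟩
      rintro t (ht | ht) s hs hsr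
      · exact h t ht s hs (hsr.trans (min_le_left _ _))
      · exact h' t ht s hs (hsr.trans (min_le_right _ _))
    · intro t _
      obtain ⟨r, hr, h⟩ := hloc t
      exact ⟨_, mem_nhdsWithin_of_mem_nhds h, r, hr, fun t' ht' => ht'⟩
  have h1 := (mem_epsSubdiff_iff hF le_rfl _).1 hu (x + r • z) (F + β' * r)
    (iSup_le fun t => hall t (mem_univ t) r hr le_rfl)
  simp only [add_sub_cancel_left, map_smul, smul_eq_mul, add_zero] at h1
  nlinarith

end SupFun

/-! ### The two subdifferential formulas. -/

theorem mainTheorem4 {X T : Type*}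
    [AddCommGroup X] [Module ℝ X] [TopologicalSpace X] [IsTopologicalAddGroup X]
    [ContinuousSMul ℝ X] [LocallyConvexSpace ℝ X] [T2Space X]
    [TopologicalSpace T] [CompactSpace T] [T2Space T] [Nonempty T]
    (f : T → X → EReal) (hf : ∀ t, IsGammaZero (f t))
    (husc : ∀ z, UpperSemicontinuous fun t => f t z) :
    ∀ x ∈ effDomain (supFun f),
      subdiff (supFun f) x =
          ⋂ (ε : ℝ) (_ : 0 < ε),
            closure (convexHull ℝ (activePart f x ε + inactiveSummand f x ε)) ∧
        (IsMinOn (supFun f) univ x →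
          subdiff (supFun f) x =
            ⋂ (ε : ℝ) (_ : 0 < ε),
              closure (convexHull ℝ (activePart f x ε ∪ inactivePart f x ε {ε}))) := by
  intro x hx
  obtain ⟨F, hF⟩ : ∃ F : ℝ, supFun f x = F := by
    obtain ⟨t⟩ := ‹Nonempty T›
    have hbot : supFun f x ≠ ⊥ := fun h =>
      (hf t).ne_bot x (le_bot_iff.1 ((le_supFun f t x).trans h.le))
    exact ⟨_, (EReal.coe_toReal (ne_of_lt hx) hbot).symm⟩
  refine ⟨Subset.antisymm ?_ ?_, fun hmin => Subset.antisymm ?_ ?_⟩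
  · intro u hu
    simp only [mem_iInter]
    intro ε hε
    by_contra hnot
    obtain ⟨z, β, hβ, hA⟩ := exists_separating_vector hnot
    -- The factor `0` isolates the active part; the factor `ε`, with `u₀` fixed, bounds the inactive
    -- part.
    have hzero : (0 : WeakDual ℝ X) ∈ inactiveSummand f x ε := by
      unfold inactiveSummand
      split_ifs with h
      · exact rfl
      · obtain ⟨t, ht⟩ := (ne_univ_iff_exists_notMem _).1 h
        obtain ⟨w, hw⟩ := epsSubdiff_weighted_nonempty hF hε (hf t)
        exact mem_iUnion₂.2 ⟨t, ht, 0, by simp, w, hw, zero_smul ℝ w⟩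
    obtain ⟨t₀, ht₀⟩ := activeSet_nonempty (husc x)
    obtain ⟨u₀, hu₀⟩ := (hf t₀).epsSubdiff_nonempty ((eq_of_mem_activeSet ht₀).trans hF) hε
    have hu₀' : u₀ ∈ activePart f x ε := mem_iUnion₂.2 ⟨t₀, ht₀, hu₀⟩
    refine hβ.not_ge (apply_le_of_mem_subdiff hF hε hf husc (fun v hv => ?_) (fun t ht => ?_) hu)
    · simpa using hA _ (add_mem_add hv hzero)
    · refine ⟨(β - u₀ z) / ε, fun w hw => (le_div_iff₀ hε).2 ?_⟩
      have hmem : ε • w ∈ inactiveSummand f x ε := by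
        rw [inactiveSummand, if_neg fun h => ht (eq_univ_iff_forall.1 h t)]
        exact mem_iUnion₂.2 ⟨t, ht, ε, by simp, w, hw, rfl⟩
      have h : u₀ z + ε * w z ≤ β := hA _ (add_mem_add hu₀' hmem)
      linarith
  · intro u hu
    simp only [mem_iInter] at hu
    refine mem_subdiff_of_forall_le hF (fun y b hb => ?_) hu
    -- Error `ε` from the active summand plus `ε * (max (b - F) 0 + 2)` from the inactive one.
    refine ⟨3 + max (b - F) 0, fun ε hε hε1 w hw => ?_⟩
    obtain ⟨u', hu', v, hv, rfl⟩ := hw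
    have h1 := apply_le_of_mem_activePart hF hε hu' hb
    have h0 : 0 ≤ max (b - F) 0 := le_max_right _ _
    have h2 : v (y - x) ≤ ε * (max (b - F) 0 + 2) := by
      have hnn : 0 ≤ ε * (max (b - F) 0 + 2) := by positivity
      unfold inactiveSummand at hv
      split_ifs at hv with h
      · rw [mem_singleton_iff.1 hv]
        exact hnn
      · obtain ⟨t, ht, l, hl, w, hw, rfl⟩ := mem_iUnion₂.1 hv
        rcases hl with rfl | rfl
        · change 0 * w (y - x) ≤ _
          rwa [zero_mul]
        · have h3 := apply_le_of_mem_weighted hF hε ((hf t).ne_bot x) hw hb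
          change l * w (y - x) ≤ _
          gcongr
          linarith
    change u' (y - x) + v (y - x) ≤ _
    linarith
  · intro u hu
    simp only [mem_iInter]
    intro ε hε
    by_contra hnot
    obtain ⟨z, β, hβ, hA⟩ := exists_separating_vector hnot
    refine hβ.not_ge (apply_le_of_mem_subdiff hF hε hf husc (fun v hv => hA v (Or.inl hv))
      (fun t ht => ⟨β / ε, fun w hw => (le_div_iff₀' hε).2 ?_⟩) hu)
    exact hA (ε • w) (Or.inr (mem_iUnion₂.2 ⟨t, ht, ε, rfl, w, hw, rfl⟩))
  · intro u hu
    simp only [mem_iInter] at hu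
    refine mem_subdiff_of_forall_le hF (fun y b hb => ⟨2, fun ε hε hε1 w hw => ?_⟩) hu
    -- Minimality enters here: with `b - F ≥ 0` and `ε ≤ 1`, `ε * (b - F) ≤ b - F`, so inactive
    -- elements need no active summand.
    have hFb : F ≤ b := by
      rw [← EReal.coe_le_coe_iff, ← hF]
      exact (hmin (mem_univ y)).trans hb
    rcases hw with hw | hw
    · linarith [apply_le_of_mem_activePart hF hε hw hb]
    · obtain ⟨t, ht, l, hl, v, hv, rfl⟩ := mem_iUnion₂.1 hw
      obtain rfl := mem_singleton_iff.1 hl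
      have h3 := apply_le_of_mem_weighted hF hε ((hf t).ne_bot x) hv hb
      rw [max_eq_left (sub_nonneg.2 hFb)] at h3
      change l * v (y - x) ≤ _
      have h4 : l * v (y - x) ≤ l * (b - F + 2 * l) := by gcongr
      nlinarith
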